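/- Let $A$ be a Dedekind domain with fraction field $K$, let $L/K$ be a finite field extension, and let $B$ be the integral closure of $A$ in $L$ (which is not assumed to be a finitely generated $A$-module). Let $\mathfrak p$ be a nonzero prime ideal of $A$, and let $K_{\mathfrak p}^*$ denote the completion of $K$ with respect to the $\mathfrak p$-adic valuation. Then there are only finitely many prime ideals $\mathfrak P$ of $B$ lying over $\mathfrak p$, for each of them the ramification index $e_{\mathfrak P}$ and the residue class degree $f_{\mathfrak P}=[B/\mathfrak P:A/\mathfrak p]$ are finite and positive, the ring $L\otimes_K K_{\mathfrak p}^*$ has a largest semisimple quotient $(L\otimes_K K_{\mathfrak p}^*)_{\mathrm{ss}}$, and $$\sum_{\mathfrak P\mid\mathfrak p} e_{\mathfrak P} f_{\mathfrak P} = [(L\otimes_K K_{\mathfrak p}^*)_{\mathrm{ss}} : K_{\mathfrak p}^*],$$ where the right-hand side is the dimension over $K_{\mathfrak p}^*$, acting through the second tensor factor. -/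

import Mathlib

open scoped TensorProduct

-- This makes `S ⊗[R] T` a `T`-algebra through its right tensor factor, `t ↦ 1 ⊗ t`.
attribute [local instance] Algebra.TensorProduct.rightAlgebra

/-- The intersection of all ideals `I` of `R` for which `R ⧸ I` is a semisimple ring. -/
def semisimpleRadical (R : Type*) [CommRing R] : Ideal R :=
  sInf {I : Ideal R | IsSemisimpleRing (R ⧸ I)}

/-- The maximal semisimple quotient of a commutative ring `R`: every semisimple quotient of `R`
factors through it. It is itself semisimple as soon as `R` has a largest semisimple quotient,
in particular when `R` is Artinian (see `isLeast_semisimpleRadical`). -/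
abbrev MaxSemisimpleQuotient (R : Type*) [CommRing R] : Type _ :=
  R ⧸ semisimpleRadical R

/-- For an Artinian ring, `semisimpleRadical R` is the least ideal with semisimple quotient, so that
`MaxSemisimpleQuotient R` is the largest semisimple quotient. -/
theorem isLeast_semisimpleRadical (R : Type*) [CommRing R] [IsArtinianRing R] :
    IsLeast {I : Ideal R | IsSemisimpleRing (R ⧸ I)} (semisimpleRadical R) := by
  have hJ : IsSemisimpleRing (R ⧸ Ring.jacobson R) :=
    IsArtinianRing.isSemisimpleRing_iff_jacobson.mpr (Ring.jacobson_quotient_jacobson R)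
  have hle : Ring.jacobson R ≤ semisimpleRadical R := by
    refine le_sInf fun I hI => ?_
    have h : IsSemisimpleRing (R ⧸ I) := hI
    exact Ring.jacobson_le_of_eq_bot (IsSemisimpleRing.jacobson_eq_bot (R ⧸ I))
  have heq : semisimpleRadical R = Ring.jacobson R := le_antisymm (sInf_le hJ) hle
  exact ⟨heq ▸ hJ, fun I hI => sInf_le hI⟩

/-! ### The ring of integers of the completion: approximation by `A` and adic completeness. -/

section AdicCompletionIntegers

open IsDedekindDomain HeightOneSpectrum WithZero IsLocalRing

variable {A : Type*} [CommRing A] [IsDedekindDomain A] (K : Type*) [Field K] [Algebra A K]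
  [IsFractionRing A K] (p : HeightOneSpectrum A)

/-! Let `O ⊆ F` be the completed ring and field, `m` the maximal ideal of `O`, `E` the reduction of
`F ⊗[A] B ≅ L ⊗[K] F`, and `D` the image of `O ⊗[A] B` in `E`. Both sides of the formula are the
rank of `D` over `O`. Since `D` spans `E`, once it is finite free its rank is `dim E`. Finiteness
must be earned, as `B` may not be finite: `D` is `m`-adically separated because `E` is reduced, and
`D/mD` is finite because `A → B` is quasi-finite, so completeness of `O` gives the rest
(`finrank_eq_finrank_fiber`). The rank is also `dim D/mD`. Passing to `D` kills only nilpotents, and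
these already lie in `m(O ⊗ B)` because `B` is integrally closed
(`IsIntegralClosure.mem_map_of_isNilpotent_tmul`). Hence `D/mD ≅ B/pB`, of dimension `∑ e f`. -/

theorem valued_algebraMap_adicCompletionIntegers (a : A) :
    Valued.v (algebraMap A (p.adicCompletionIntegers K) a : p.adicCompletion K) =
      p.intValuation a := by
  rw [algebraMap_adicCompletionIntegers_apply, valuedAdicCompletion_eq_valuation',
    valuation_of_algebraMap]

theorem mem_maximalIdeal_pow_adicCompletionIntegers_iff (x : p.adicCompletionIntegers K) (n : ℕ) :
    x ∈ maximalIdeal (p.adicCompletionIntegers K) ^ n ↔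
      Valued.v (x : p.adicCompletion K) ≤ exp (-(n : ℤ)) := by
  obtain ⟨ϖ, hϖ⟩ := p.intValuation_exists_uniformizer
  set π := algebraMap A (p.adicCompletionIntegers K) ϖ with hπ
  have hv : Valued.v (π : p.adicCompletion K) = exp (-1 : ℤ) := by
    rw [hπ, valued_algebraMap_adicCompletionIntegers, hϖ]
  have hdvd (y z : p.adicCompletionIntegers K) :
      y ∣ z ↔ Valued.v (z : p.adicCompletion K) ≤ Valued.v (y : p.adicCompletion K) :=
    (adicCompletionIntegers.integers (K := K) (v := p)).dvd_iff_le
  have hm : maximalIdeal (p.adicCompletionIntegers K) = Ideal.span {π} := by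
    ext y
    rw [Ideal.mem_span_singleton, hdvd, hv, mem_maximalIdeal, mem_nonunits_iff,
      adicCompletionIntegers.isUnit_iff_valued_eq_one]
    have h1 : Valued.v (y : p.adicCompletion K) ≤ 1 := y.2
    rw [← ne_eq, ← h1.lt_iff_ne]
    generalize Valued.v (y : p.adicCompletion K) = t
    rw [← exp_zero]
    cases t using WithZero.expRecOn with
    | zero => simp
    | exp a => simp only [exp_lt_exp, exp_le_exp]; omega
  rw [hm, Ideal.span_singleton_pow, Ideal.mem_span_singleton, hdvd]
  push_cast
  rw [map_pow, hv, ← exp_nsmul]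
  simp

theorem algebraMap_mem_maximalIdeal_pow_iff (a : A) (n : ℕ) :
    algebraMap A (p.adicCompletionIntegers K) a ∈
      maximalIdeal (p.adicCompletionIntegers K) ^ n ↔ a ∈ p.asIdeal ^ n := by
  rw [mem_maximalIdeal_pow_adicCompletionIntegers_iff, valued_algebraMap_adicCompletionIntegers,
    intValuation_le_pow_iff_mem]

theorem exists_valued_adicCompletion_eq_exp (n : ℤ) :
    ∃ z : p.adicCompletion K, Valued.v z = exp n :=
  valuedAdicCompletion_surjective K p _

theorem isOpen_valued_sub_le_exp (x : p.adicCompletion K) (n : ℤ) :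
    IsOpen {y : p.adicCompletion K | Valued.v (y - x) ≤ exp n} := by
  obtain ⟨z, hz⟩ := exists_valued_adicCompletion_eq_exp K p n
  have hz0 : (Valued.v : Valuation (p.adicCompletion K) ℤᵐ⁰).restrict z ≠ 0 := by
    simp [← (Valued.v : Valuation (p.adicCompletion K) ℤᵐ⁰).ne_zero_iff, hz]
  have := (Valued.isOpen_closedBall (p.adicCompletion K) hz0).preimage
    (continuous_id.sub (continuous_const (y := x)))
  simpa only [Set.preimage_ofPred_eq, Valuation.restrict_le_iff, hz, id, Pi.sub_apply] using this

theorem isClosed_valued_sub_le_exp (x : p.adicCompletion K) (n : ℤ) :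
    IsClosed {y : p.adicCompletion K | Valued.v (y - x) ≤ exp n} := by
  obtain ⟨z, hz⟩ := exists_valued_adicCompletion_eq_exp K p n
  have := (Valued.isClosed_closedBall (p.adicCompletion K)
    ((Valued.v : Valuation (p.adicCompletion K) ℤᵐ⁰).restrict z)).preimage
    (continuous_id.sub (continuous_const (y := x)))
  simpa only [Set.preimage_ofPred_eq, Valuation.restrict_le_iff, hz, id, Pi.sub_apply] using this

/-- Two approximations: by an element of `K`, by density, which is then `p`-integral and so is close
to an element of `A`. -/
theorem exists_sub_algebraMap_mem_maximalIdeal_pow (x : p.adicCompletionIntegers K) (n : ℕ) :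
    ∃ a : A, x - algebraMap A (p.adicCompletionIntegers K) a ∈
      maximalIdeal (p.adicCompletionIntegers K) ^ n := by
  obtain ⟨k, hk⟩ := (denseRange_algebraMap K p).exists_mem_open
    (isOpen_valued_sub_le_exp K p x (-(n : ℤ))) ⟨x, by simp⟩
  have hn : exp (-(n : ℤ)) ≤ (1 : ℤᵐ⁰) := by rw [← exp_zero, exp_le_exp]; omega
  have hk1 : p.valuation K k ≤ 1 := by
    rw [← valuedAdicCompletion_eq_valuation']
    have := Valued.v.map_add_le (hk.trans hn) x.2
    rwa [sub_add_cancel] at this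
  obtain ⟨a, ha⟩ := p.exists_valuation_sub_lt_of_integer hk1
    (Units.mk0 (exp (-(n : ℤ))) exp_ne_zero)
  refine ⟨a, (mem_maximalIdeal_pow_adicCompletionIntegers_iff K p _ n).2 ?_⟩
  rw [← valuedAdicCompletion_eq_valuation'] at ha
  have hcoe (z : K) : (z : p.adicCompletion K) = algebraMap K (p.adicCompletion K) z := rfl
  rw [hcoe, map_sub] at ha
  have := Valued.v.map_add_le ha.le hk
  rw [sub_add_sub_cancel, Units.val_mk0] at this
  rw [← neg_sub, NegMemClass.coe_neg, Valuation.map_neg]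
  exact this

instance : IsAdicComplete (maximalIdeal (p.adicCompletionIntegers K))
    (p.adicCompletionIntegers K) where
  prec' f hf := by
    have hf' {m n : ℕ} (h : m ≤ n) :
        Valued.v ((f n : p.adicCompletion K) - f m) ≤ exp (-(m : ℤ)) := by
      have := hf h
      rw [SModEq.sub_mem, smul_eq_mul, Ideal.mul_top,
        mem_maximalIdeal_pow_adicCompletionIntegers_iff] at this
      rw [Valuation.map_sub_swap]
      exact this
    have hc : CauchySeq fun n => (f n : p.adicCompletion K) := by
      rw [(Valued.hasBasis_uniformity (p.adicCompletion K) ℤᵐ⁰).cauchySeq_iff']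
      intro γ _
      obtain ⟨N, hN⟩ : ∃ N : ℕ, exp (-(N : ℤ)) <
          MonoidWithZeroHom.ValueGroup₀.embedding γ.1 := by
        have h0 : MonoidWithZeroHom.ValueGroup₀.embedding γ.1 ≠ (0 : ℤᵐ⁰) := by simp
        obtain ⟨a, ha⟩ : ∃ a : ℤ, exp a = MonoidWithZeroHom.ValueGroup₀.embedding γ.1 :=
          ⟨_, exp_log h0⟩
        refine ⟨a.natAbs + 1, ?_⟩
        rw [← ha, exp_lt_exp]
        omega
      refine ⟨N, fun n hn => ?_⟩
      rw [Set.mem_ofPred_eq, Valuation.restrict_lt_iff_lt_embedding, Valuation.map_sub_swap]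
      exact (hf' hn).trans_lt hN
    obtain ⟨l, hl⟩ := cauchySeq_tendsto_of_complete hc
    -- Balls are closed, so the limit inherits the congruences satisfied by the tail.
    have hmem (n : ℕ) : Valued.v (l - f n) ≤ exp (-(n : ℤ)) :=
      (isClosed_valued_sub_le_exp K p (f n) (-(n : ℤ))).mem_of_tendsto hl
        (Filter.eventually_atTop.2 ⟨n, fun m hm => hf' hm⟩)
    have hl1 : Valued.v l ≤ 1 := by
      have := Valued.v.map_add_le ((hmem 0).trans (by simp)) (f 0).2
      rwa [sub_add_cancel] at this
    refine ⟨⟨l, hl1⟩, fun n => ?_⟩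
    rw [SModEq.sub_mem, smul_eq_mul, Ideal.mul_top, ← neg_mem_iff, neg_sub,
        mem_maximalIdeal_pow_adicCompletionIntegers_iff]
    exact hmem n

end AdicCompletionIntegers

/-! ### Finiteness and ranks over a complete discrete valuation ring. -/

section CompleteLocal

open IsLocalRing

theorem IsPrecomplete.of_finite {R : Type*} [CommRing R] (I : Ideal R) [IsAdicComplete I R]
    (M : Type*) [AddCommGroup M] [Module R M] [Module.Finite R M] : IsPrecomplete I M := by
  rw [← AdicCompletion.of_surjective_iff]
  intro y
  obtain ⟨t, rfl⟩ := AdicCompletion.ofTensorProduct_surjective_of_finite I M y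
  induction t using TensorProduct.induction_on with
  | zero => exact ⟨0, by simp⟩
  | tmul r x =>
    obtain ⟨r, rfl⟩ := AdicCompletion.of_surjective I R r
    refine ⟨r • x, ?_⟩
    rw [AdicCompletion.ofTensorProduct_tmul]
    ext n
    simp only [map_smul]
    rfl
  | add a b ha hb =>
    obtain ⟨x, hx⟩ := ha
    obtain ⟨z, hz⟩ := hb
    exact ⟨x + z, by rw [map_add, hx, hz, map_add]⟩

/-- Nakayama with completeness in place of finiteness: lifted generators define a map from `R ^ n`,
surjective modulo `I`; successive approximation converges in `R ^ n`, and its limit is correct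
because `M` is separated. -/
theorem Module.Finite.of_isHausdorff {R : Type*} [CommRing R] (I : Ideal R) [IsAdicComplete I R]
    (M : Type*) [AddCommGroup M] [Module R M] [IsHausdorff I M]
    [Module.Finite R (M ⧸ (I • ⊤ : Submodule R M))] : Module.Finite R M := by
  obtain ⟨n, f, hf⟩ := Module.Finite.exists_fin' R (M ⧸ (I • ⊤ : Submodule R M))
  obtain ⟨g, hg⟩ := Module.projective_lifting_property (I • ⊤ : Submodule R M).mkQ f
    (Submodule.mkQ_surjective _)
  have := IsPrecomplete.of_finite I (Fin n → R)
  exact .of_surjective g (surjective_of_mkQ_comp_surjective (I := I) (hg ▸ hf))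

theorem Module.Finite.quotient_smul_top_of_fiber {R : Type*} [CommRing R] (I : Ideal R)
    [I.IsMaximal] (M : Type*) [AddCommGroup M] [Module R M]
    [Module.Finite I.ResidueField (I.Fiber M)] :
    Module.Finite R (M ⧸ (I • ⊤ : Submodule R M)) := by
  have hb := Ideal.bijective_algebraMap_quotient_residueField I
  have : Module.Finite R I.ResidueField := by
    refine .of_surjective (Algebra.linearMap R I.ResidueField) ?_
    have h := hb.2.comp (Ideal.Quotient.mk_surjective (I := I))
    intro x
    obtain ⟨r, hr⟩ := h x
    exact ⟨r, by rw [← hr]; rfl⟩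
  have : Module.Finite R (I.Fiber M) := .trans I.ResidueField _
  let e : (R ⧸ I) ≃ₗ[R] I.ResidueField :=
    (AlgEquiv.ofBijective (IsScalarTower.toAlgHom R (R ⧸ I) I.ResidueField) hb).toLinearEquiv
  exact .equiv ((LinearEquiv.rTensor M e).symm ≪≫ₗ TensorProduct.quotTensorEquivQuotSMul M I)

/-- If `x ≠ 0`, some `a ≠ 0` in `O` makes `a x⁻¹` integral. Multiplying by `y = x / ϖ ^ n` shows `a
/ ϖ ^ n` integral, hence in `O`, for every `n`, which is absurd. -/
theorem eq_zero_of_forall_eq_pow_smul_isIntegral_of_field {O F M : Type*} [CommRing O] [IsDomain O]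
    [IsDiscreteValuationRing O] [Field F] [Algebra O F] [IsFractionRing O F] [Field M]
    [Algebra F M] [Algebra O M] [IsScalarTower O F M] [FiniteDimensional F M]
    {ϖ : O} (hϖ : Irreducible ϖ) (x : M)
    (hx : ∀ n : ℕ, ∃ y : M, IsIntegral O y ∧ x = ϖ ^ n • y) : x = 0 := by
  by_contra hx0
  have halg : IsAlgebraic O x⁻¹ :=
    (IsFractionRing.isAlgebraic_iff O F M).2 (Algebra.IsAlgebraic.isAlgebraic _)
  obtain ⟨a, ha0, ha⟩ := halg.exists_integral_multiple
  obtain ⟨n, hn⟩ : ∃ n : ℕ, a ∉ maximalIdeal O ^ n := by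
    by_contra! h
    refine ha0 (IsHausdorff.haus (I := maximalIdeal O) inferInstance a fun n => ?_)
    simpa [SModEq.zero] using h n
  obtain ⟨y, hy, hxy⟩ := hx n
  have hy0 : y ≠ 0 := by rintro rfl; exact hx0 (by simpa using hxy)
  have hϖ0 : algebraMap O F ϖ ≠ 0 := by simpa using hϖ.ne_zero
  have hint : IsIntegral O (algebraMap F M (algebraMap O F a / algebraMap O F ϖ ^ n)) := by
    convert! ha.mul hy using 1
    rw [hxy]
    simp only [Algebra.smul_def, IsScalarTower.algebraMap_apply O F M, map_div₀, map_pow]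
    have : algebraMap F M (algebraMap O F ϖ) ≠ 0 := by simpa using hϖ.ne_zero
    field_simp
  rw [isIntegral_algebraMap_iff (algebraMap F M).injective, IsIntegrallyClosed.isIntegral_iff] at hint
  obtain ⟨b, hb⟩ := hint
  apply hn
  rw [hϖ.maximalIdeal_eq, Ideal.span_singleton_pow, Ideal.mem_span_singleton]
  refine ⟨b, IsFractionRing.injective O F ?_⟩
  rw [map_mul, hb, map_pow]
  field_simp

/-- Nonzero elements of a finite reduced algebra over the fraction field of a discrete valuation
ring are not infinitely divisible among integral elements. -/
theorem eq_zero_of_forall_eq_pow_smul_isIntegral {O F E : Type*} [CommRing O] [IsDomain O]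
    [IsDiscreteValuationRing O] [Field F] [Algebra O F] [IsFractionRing O F] [CommRing E]
    [IsReduced E] [Algebra F E] [Algebra O E] [IsScalarTower O F E] [FiniteDimensional F E]
    {ϖ : O} (hϖ : Irreducible ϖ) (x : E)
    (hx : ∀ n : ℕ, ∃ y : E, IsIntegral O y ∧ x = ϖ ^ n • y) : x = 0 := by
  have : IsArtinianRing E := .of_finite F E
  -- As `E` is reduced, vanishing can be tested in the residue fields `E ⧸ P`.
  rw [← Ideal.mem_bot, ← Ideal.zero_eq_bot, ← nilradical_eq_zero E, nilradical_eq_sInf,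
    Ideal.mem_sInf]
  intro P hP
  have : P.IsPrime := hP
  have : P.IsMaximal := inferInstance
  let : Field (E ⧸ P) := Ideal.Quotient.field P
  rw [← Ideal.Quotient.eq_zero_iff_mem]
  refine eq_zero_of_forall_eq_pow_smul_isIntegral_of_field (F := F) hϖ _ fun n => ?_
  obtain ⟨y, hy, rfl⟩ := hx n
  exact ⟨Ideal.Quotient.mk P y, hy.map (Ideal.Quotient.mkₐ O P), rfl⟩

theorem LinearMap.baseChange_bijective_of_ker_le {R M N : Type*} [CommRing R] [AddCommGroup M]
    [AddCommGroup N] [Module R M] [Module R N] (I : Ideal R) [I.IsPrime] (f : M →ₗ[R] N)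
    (hf : Function.Surjective f) (hker : LinearMap.ker f ≤ I • ⊤) :
    Function.Bijective (f.baseChange I.ResidueField) := by
  refine ⟨?_, LinearMap.lTensor_surjective _ hf⟩
  rw [← LinearMap.ker_eq_bot, eq_bot_iff]
  intro x hx
  have hex := lTensor_exact I.ResidueField (LinearMap.exact_subtype_ker_map f) hf
  obtain ⟨z, rfl⟩ := (hex x).1 hx
  suffices h : LinearMap.lTensor I.ResidueField (LinearMap.ker f).subtype = 0 by
    rw [h]; simp
  ext k ⟨m, hm⟩
  simp only [TensorProduct.AlgebraTensorModule.curry_apply, TensorProduct.curry_apply,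
    LinearMap.coe_restrictScalars, LinearMap.lTensor_tmul, Submodule.subtype_apply,
    LinearMap.zero_apply]
  have hm' := hker hm
  clear hm
  induction hm' using Submodule.smul_induction_on' with
  | smul r hr n _ =>
    rw [← TensorProduct.smul_tmul, Algebra.smul_def, (Ideal.algebraMap_residueField_eq_zero).2 hr,
      zero_mul, TensorProduct.zero_tmul]
  | add a _ b _ ha hb => rw [TensorProduct.tmul_add, ha, hb, add_zero]

theorem finrank_eq_finrank_fiber {O F E C : Type*} [CommRing O] [IsDomain O]
    [IsDiscreteValuationRing O] [IsAdicComplete (maximalIdeal O) O]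
    [Field F] [Algebra O F] [IsFractionRing O F] [CommRing E]
    [IsReduced E] [Algebra F E] [Algebra O E] [IsScalarTower O F E] [FiniteDimensional F E]
    [CommRing C] [Algebra O C] [Algebra.IsIntegral O C] (ψ : C →ₐ[O] E)
    (hspan : Submodule.span F (Set.range ψ) = ⊤)
    (hker : ∀ c, ψ c = 0 → c ∈ (maximalIdeal O).map (algebraMap O C))
    [Module.Finite (maximalIdeal O).ResidueField ((maximalIdeal O).Fiber C)] :
    Module.finrank F E = Module.finrank (maximalIdeal O).ResidueField
      ((maximalIdeal O).Fiber C) := by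
  let D := ψ.range
  let φ : C →ₐ[O] D := ψ.rangeRestrict
  have hφ : Function.Surjective φ := ψ.rangeRestrict_surjective
  have : Module.IsTorsionFree O E := .trans_faithfulSMul O F E
  have : Algebra.IsIntegral O D := .of_surjective φ hφ
  have hbij := LinearMap.baseChange_bijective_of_ker_le (maximalIdeal O) φ.toLinearMap hφ
    fun c hc => by
      rw [Ideal.smul_top_eq_map]
      exact hker c congr($(LinearMap.mem_ker.1 hc).1)
  let e := LinearEquiv.ofBijective _ hbij
  rw [e.finrank_eq]
  have : Module.Finite (maximalIdeal O).ResidueField ((maximalIdeal O).Fiber D) := .equiv e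
  have : IsHausdorff (maximalIdeal O) D := by
    obtain ⟨ϖ, hϖ⟩ := IsDiscreteValuationRing.exists_irreducible O
    refine ⟨fun x hx => Subtype.ext ?_⟩
    refine eq_zero_of_forall_eq_pow_smul_isIntegral (F := F) hϖ _ fun n => ?_
    have h := hx n
    rw [SModEq.zero, hϖ.maximalIdeal_eq, Ideal.span_singleton_pow,
      Submodule.ideal_span_singleton_smul] at h
    obtain ⟨y, -, rfl⟩ := (Submodule.mem_smul_pointwise_iff_exists _ _ _).1 h
    exact ⟨y, (Algebra.IsIntegral.isIntegral (R := O) y).map D.val, rfl⟩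
  have := Module.Finite.quotient_smul_top_of_fiber (maximalIdeal O) D
  have : Module.Finite O D := .of_isHausdorff (maximalIdeal O) D
  have : Module.IsTorsionFree O D := Subtype.val_injective.moduleIsTorsionFree _ fun _ _ => rfl
  rw [Ideal.finrank_fiber_eq_finrank]
  -- An `O`-basis of `D` is an `F`-basis of `E`.
  let b := Module.Free.chooseBasis O D
  have hli : LinearIndependent F fun i => (b i : E) :=
    (LinearIndependent.iff_fractionRing O F).1
      (b.linearIndependent.map' D.val.toLinearMap
        (LinearMap.ker_eq_bot.2 Subtype.val_injective))
  have hsp : ⊤ ≤ Submodule.span F (Set.range fun i => (b i : E)) := by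
    rw [← hspan, Submodule.span_le]
    rintro _ ⟨c, rfl⟩
    have h : φ c ∈ Submodule.span O (Set.range b) := by rw [b.span_eq]; trivial
    have h' := Submodule.mem_map_of_mem (f := D.val.toLinearMap) h
    rw [Submodule.map_span, ← Set.range_comp] at h'
    exact Submodule.span_le_restrictScalars O F _ h'
  rw [Module.finrank_eq_card_basis (Module.Basis.mk hli hsp), Module.finrank_eq_card_basis b]

end CompleteLocal

/-! ### Quasi-finiteness of the integral closure. -/

section QuasiFinite

/-- Finitely many independent vectors of the fiber come from a finitely generated `N`; flatness
makes the fiber dimension of `N` its rank, at most `n`. -/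
theorem Module.finite_fiber_of_forall_finrank_le {R : Type*} [CommRing R] [IsDomain R]
    (P : Ideal R) [P.IsPrime] (M : Type*) [AddCommGroup M] [Module R M] (n : ℕ)
    (h : ∀ N : Submodule R M, Module.Finite R N → Module.Flat R N ∧ Module.finrank R N ≤ n) :
    Module.Finite P.ResidueField (P.Fiber M) := by
  have hrank : Module.rank P.ResidueField (P.Fiber M) ≤ n := by
    refine rank_le fun s hs => ?_
    obtain ⟨N, hN, hsub⟩ :=
      TensorProduct.exists_finite_submodule_right_of_setFinite (s : Set (P.Fiber M)) s.finite_toSet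
    obtain ⟨_, hle⟩ := h N hN
    let g : P.Fiber N →ₗ[P.ResidueField] P.Fiber M := N.subtype.baseChange P.ResidueField
    have hsub' : Submodule.span P.ResidueField (s : Set (P.Fiber M)) ≤ LinearMap.range g :=
      Submodule.span_le.2 hsub
    rw [← finrank_span_finset_eq_card hs]
    refine (Submodule.finrank_mono hsub').trans ?_
    refine (LinearMap.finrank_range_le g).trans ?_
    rwa [Ideal.finrank_fiber_eq_finrank]
  exact Module.rank_lt_aleph0_iff.1 (hrank.trans_lt (Cardinal.natCast_lt_aleph0))

theorem IsIntegralClosure.quasiFinite (A K L B : Type*) [CommRing A] [IsDedekindDomain A]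
    [Field K] [Algebra A K]
    [IsFractionRing A K] [Field L] [Algebra K L] [FiniteDimensional K L] [Algebra A L]
    [IsScalarTower A K L] [CommRing B] [Algebra A B] [Algebra B L] [IsScalarTower A B L]
    [IsIntegralClosure B A L] : Algebra.QuasiFinite A B := by
  have : Module.IsTorsionFree A L := .trans_faithfulSMul A K L
  have : Module.IsTorsionFree A B := IsIntegralClosure.isTorsionFree A L
  refine ⟨fun P _ => Module.finite_fiber_of_forall_finrank_le P B (Module.finrank K L)
    fun N _ => ⟨?_, ?_⟩⟩
  · have : Module.IsTorsionFree A N := Subtype.val_injective.moduleIsTorsionFree _ fun _ _ => rfl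
    infer_instance
  · have hinj : Function.Injective
        ((IsScalarTower.toAlgHom A B L).toLinearMap ∘ₗ N.subtype) :=
      (IsIntegralClosure.algebraMap_injective B A L).comp N.subtype_injective
    have hr := LinearMap.lift_rank_le_of_injective _ hinj
    rw [← IsLocalization.rank_eq K (nonZeroDivisors A) le_rfl (N := L)] at hr
    simpa [Module.finrank] using Cardinal.toNat_le_toNat hr
      (Cardinal.lift_lt_aleph0.2 (Module.rank_lt_aleph0 K L))

end QuasiFinite

/-! ### Ramification indices, residue degrees and the fiber. -/

section RamificationInertia

theorem Ideal.ramificationIdx_pos_of_quasiFinite {R S : Type*} [CommRing R] [CommRing S]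
    [Algebra R S] [Algebra.QuasiFinite R S] (q : Ideal S) [q.IsPrime] :
    0 < q.ramificationIdx R := by
  let p := q.under R
  let Sq := Localization.AtPrime q
  rw [ramificationIdx_def]
  -- `toNat` sends `⊤` to `0`, so positivity also encodes finite length.
  apply ENat.toNat_pos
  · rw [← pos_iff_ne_zero, Module.length_pos_iff, Submodule.Quotient.nontrivial_iff,
      IsScalarTower.algebraMap_eq R S, ← map_map, ← lt_top_iff_ne_top]
    grw [map_mono map_comap_le, Localization.AtPrime.map_eq_maximalIdeal]
    exact (IsLocalRing.maximalIdeal.isMaximal _).lt_top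
  · let r := PrimeSpectrum.primesOverOrderIsoFiber R S p (primesOver.mk p q)
    have : q = r.1.comap Algebra.TensorProduct.includeRight := by
      rw [← PrimeSpectrum.coe_primesOverOrderIsoFiber_symm_apply, OrderIso.symm_apply_apply]
    let := Localization.AtPrime.algebraOfLiesOver p (r.1.comap Algebra.TensorProduct.includeRight)
    have : IsArtinianRing (Sq ⧸ map (algebraMap R Sq) p) := by
      convert! (Fiber.localizationAlgEquivQuotient p r.1).toRingEquiv.isArtinianRing
    rwa [Module.length_eq_of_surjective (R := Sq ⧸ p.map (algebraMap R Sq)) Quotient.mk_surjective,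
      Module.length_ne_top_iff, ← isArtinianRing_iff_isFiniteLength]

theorem Ideal.inertiaDeg_pos_of_quasiFinite {R S : Type*} [CommRing R] [CommRing S]
    [Algebra R S] [Algebra.QuasiFinite R S] (q : Ideal S) [q.IsPrime] :
    0 < q.inertiaDeg R := by
  let := Localization.AtPrime.algebraOfLiesOver (q.under R) q
  rw [inertiaDeg_def]
  exact Module.finrank_pos

theorem Ideal.finsum_ramificationIdx_mul_inertiaDeg {R : Type*} [CommRing R] (p : Ideal R)
    [p.IsPrime] (S : Type*) [CommRing S] [Algebra R S] [Algebra.QuasiFinite R S] :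
    ∑ᶠ P ∈ p.primesOver S, P.ramificationIdx R * P.inertiaDeg R =
      Module.finrank p.ResidueField (p.Fiber S) := by
  have := (Algebra.QuasiFinite.finite_primesOver (S := S) p).fintype
  rw [← sum_ramification_inertia_eq_finrank_fiber, finsum_mem_eq_finite_toFinset_sum _
    (Set.toFinite _)]
  exact (Finset.sum_subtype _ (by simp) _)

/-- The rank of the fiber is unchanged by base change. -/
theorem Ideal.finrank_fiber_baseChange {R : Type*} [CommRing R] (S O : Type*) [CommRing S]
    [Algebra R S] [CommRing O] [Algebra R O] (P : Ideal O) [P.IsPrime] (p : Ideal R) [p.IsPrime]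
    [hP : P.LiesOver p] :
    Module.finrank P.ResidueField (P.Fiber (O ⊗[R] S)) =
      Module.finrank p.ResidueField (p.Fiber S) := by
  let := Localization.AtPrime.algebraOfLiesOver p P
  let e : P.Fiber (O ⊗[R] S) ≃ₐ[P.ResidueField] P.ResidueField ⊗[p.ResidueField] (p.Fiber S) :=
    (Algebra.TensorProduct.cancelBaseChange _ _ _ _ _).trans
      (Algebra.TensorProduct.cancelBaseChange _ _ _ _ _).symm
  rw [e.toLinearEquiv.finrank_eq, Module.finrank_baseChange]

end RamificationInertia

/-! ### Nilpotents of the base change lie in the extended maximal ideal. -/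

section Nilpotent

open nonZeroDivisors

/-- For `c ∈ I⁻¹`, `(c b) ^ n` lies in `B`, hence so does `c b`. Thus `I⁻¹ b ⊆ B`, and multiplying
by `I` gives `b ∈ I B`. -/
theorem IsIntegralClosure.mem_map_of_pow_mem_map_pow {A : Type*} (K L : Type*) {B : Type*}
    [CommRing A] [IsDedekindDomain A] [Field K] [Algebra A K]
    [IsFractionRing A K] [Field L] [Algebra K L] [Algebra A L]
    [IsScalarTower A K L] [CommRing B] [Algebra A B] [Algebra B L] [IsScalarTower A B L]
    [IsIntegralClosure B A L] {I : Ideal A} (hI : I ≠ ⊥) {b : B} {n : ℕ} (hn : 0 < n)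
    (h : b ^ n ∈ (I ^ n).map (algebraMap A B)) : b ∈ I.map (algebraMap A B) := by
  set J : FractionalIdeal A⁰ K := (I : FractionalIdeal A⁰ K)⁻¹ with hJ
  have hIJ : (I : FractionalIdeal A⁰ K) * J = 1 :=
    mul_inv_cancel₀ (FractionalIdeal.coeIdeal_ne_zero.2 hI)
  have hpow (c : K) (hc : c ∈ J) (y : B) (hy : y ∈ (I ^ n).map (algebraMap A B)) :
      ∃ z : B, algebraMap B L z = algebraMap K L (c ^ n) * algebraMap B L y := by
    induction hy using Submodule.span_induction with
    | mem y hy =>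
      obtain ⟨a, ha, rfl⟩ := hy
      have h1 : algebraMap A K a * c ^ n ∈ (1 : FractionalIdeal A⁰ K) := by
        rw [← one_pow n, ← hIJ, mul_pow, ← FractionalIdeal.coeIdeal_pow]
        exact FractionalIdeal.mul_mem_mul (FractionalIdeal.mem_coeIdeal_of_mem _ ha)
          (by
            rw [← FractionalIdeal.mem_coe, FractionalIdeal.coe_pow]
            exact Submodule.pow_mem_pow _ hc n)
      obtain ⟨a', ha'⟩ := (FractionalIdeal.mem_one_iff _).1 h1
      refine ⟨algebraMap A B a', ?_⟩
      rw [← IsScalarTower.algebraMap_apply, ← IsScalarTower.algebraMap_apply,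
        IsScalarTower.algebraMap_apply A K L, ha', map_mul, ← IsScalarTower.algebraMap_apply,
        mul_comm]
    | zero => exact ⟨0, by simp⟩
    | add y z _ _ hy hz =>
      obtain ⟨y', hy'⟩ := hy
      obtain ⟨z', hz'⟩ := hz
      exact ⟨y' + z', by rw [map_add, hy', hz', map_add, mul_add]⟩
    | smul s y _ hy =>
      obtain ⟨y', hy'⟩ := hy
      exact ⟨s * y', by rw [map_mul, hy', smul_eq_mul, map_mul, mul_left_comm]⟩
  have hdiv (c : K) (hc : c ∈ J) :
      ∃ z : B, algebraMap B L z = algebraMap K L c * algebraMap B L b := by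
    refine (IsIntegralClosure.isIntegral_iff (R := A)).1 (.of_pow hn ?_)
    obtain ⟨z, hz⟩ := hpow c hc _ h
    rw [mul_pow, ← map_pow, ← map_pow, ← hz]
    exact IsIntegralClosure.isIntegral_iff.2 ⟨z, rfl⟩
  have key (x : K) (hx : x ∈ (I : FractionalIdeal A⁰ K) * J) :
      ∃ z ∈ I.map (algebraMap A B), algebraMap B L z = algebraMap K L x * algebraMap B L b := by
    refine FractionalIdeal.mul_induction_on hx (fun i hi j hj => ?_) fun x y hx hy => ?_
    · obtain ⟨a, ha, rfl⟩ := (FractionalIdeal.mem_coeIdeal _).1 hi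
      obtain ⟨z, hz⟩ := hdiv j hj
      refine ⟨algebraMap A B a * z, Ideal.mul_mem_right _ _ (Ideal.mem_map_of_mem _ ha), ?_⟩
      rw [map_mul, hz, map_mul, ← IsScalarTower.algebraMap_apply,
        ← IsScalarTower.algebraMap_apply, mul_assoc]
    · obtain ⟨x', hx, hx'⟩ := hx
      obtain ⟨y', hy, hy'⟩ := hy
      exact ⟨x' + y', add_mem hx hy, by rw [map_add, hx', hy', map_add, add_mul]⟩
  obtain ⟨z, hz, hzb⟩ := key 1 (by rw [hIJ]; exact FractionalIdeal.one_mem_one _)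
  rw [map_one, one_mul] at hzb
  rwa [← IsIntegralClosure.algebraMap_injective B A L hzb]

variable {A O B : Type*} [CommRing A] [CommRing O] [Algebra A O] [CommRing B] [Algebra A B]

theorem exists_sub_one_tmul_mem_map (J : Ideal O)
    (hJ : ∀ x : O, ∃ a : A, x - algebraMap A O a ∈ J) (c : O ⊗[A] B) :
    ∃ b : B, c - 1 ⊗ₜ b ∈ J.map (algebraMap O (O ⊗[A] B)) := by
  induction c using TensorProduct.induction_on with
  | zero => exact ⟨0, by simp⟩
  | tmul x b =>
    obtain ⟨a, ha⟩ := hJ x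
    refine ⟨a • b, ?_⟩
    have : x ⊗ₜ[A] b - 1 ⊗ₜ (a • b) =
        algebraMap O (O ⊗[A] B) (x - algebraMap A O a) * 1 ⊗ₜ b := by
      rw [← TensorProduct.smul_tmul, ← TensorProduct.sub_tmul,
        Algebra.TensorProduct.algebraMap_apply, Algebra.TensorProduct.tmul_mul_tmul]
      simp [Algebra.algebraMap_eq_smul_one]
    rw [this]
    exact Ideal.mul_mem_right _ _ (Ideal.mem_map_of_mem _ ha)
  | add c d hc hd =>
    obtain ⟨b, hb⟩ := hc
    obtain ⟨b', hb'⟩ := hd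
    refine ⟨b + b', ?_⟩
    rw [TensorProduct.tmul_add, add_sub_add_comm]
    exact add_mem hb hb'

/-- By flatness the injection `A ⧸ I → O ⧸ J` stays injective after tensoring with `B`. -/
theorem mem_map_of_one_tmul_mem_map [Module.Flat A B] (I : Ideal A) (J : Ideal O)
    (hIJ : J.comap (algebraMap A O) = I) (b : B)
    (hb : (1 : O) ⊗ₜ[A] b ∈ J.map (algebraMap O (O ⊗[A] B))) :
    b ∈ I.map (algebraMap A B) := by
  let q : O ⊗[A] B →ₐ[A] (O ⧸ J) ⊗[A] B :=
    Algebra.TensorProduct.map (Ideal.Quotient.mkₐ A J) (.id A B)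
  have hq : J.map (algebraMap O (O ⊗[A] B)) ≤ RingHom.ker q := by
    rw [Ideal.map_le_iff_le_comap]
    intro x hx
    simp [q, RingHom.mem_ker, Ideal.Quotient.eq_zero_iff_mem.2 hx]
  have h0 : (1 : O ⧸ J) ⊗ₜ[A] b = 0 := by
    simpa [q] using hq hb
  let f : (A ⧸ I) →ₐ[A] (O ⧸ J) := Ideal.quotientMapₐ J (Algebra.ofId A O) hIJ.ge
  have hf : Function.Injective f := Ideal.quotientMap_injective' (H := hIJ.ge) hIJ.le
  have h1 : (1 : A ⧸ I) ⊗ₜ[A] b = 0 := by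
    refine Module.Flat.rTensor_preserves_injective_linearMap (M := B) f.toLinearMap hf ?_
    rw [LinearMap.rTensor_tmul, map_zero, ← h0]
    simp
  have h2 := congr(TensorProduct.quotTensorEquivQuotSMul B I $h1)
  rw [← map_one (Ideal.Quotient.mk I), TensorProduct.quotTensorEquivQuotSMul_mk_tmul, one_smul,
    map_zero, Submodule.Quotient.mk_eq_zero, Ideal.smul_top_eq_map] at h2
  exact h2

end Nilpotent

theorem IsIntegralClosure.mem_map_of_isNilpotent_tmul {A O : Type*} (K L : Type*) {B : Type*}
    [CommRing A] [IsDedekindDomain A] [Field K] [Algebra A K]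
    [IsFractionRing A K] [Field L] [Algebra K L] [Algebra A L]
    [IsScalarTower A K L] [CommRing B] [Algebra A B] [Algebra B L] [IsScalarTower A B L]
    [IsIntegralClosure B A L] [CommRing O] [Algebra A O] {I : Ideal A} (hI : I ≠ ⊥) (J : Ideal O)
    (hJ : ∀ (x : O) (n : ℕ), ∃ a : A, x - algebraMap A O a ∈ J ^ n)
    (hIJ : ∀ n : ℕ, (J ^ n).comap (algebraMap A O) = I ^ n)
    {c : O ⊗[A] B} (hc : IsNilpotent c) : c ∈ J.map (algebraMap O (O ⊗[A] B)) := by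
  have : Module.IsTorsionFree A L := .trans_faithfulSMul A K L
  have : Module.IsTorsionFree A B := IsIntegralClosure.isTorsionFree A L
  obtain ⟨k, hk⟩ := hc
  -- The precision matches the exponent: `c ^ (k + 1) = 0` puts `b ^ (k + 1)` in `I ^ (k + 1) B`, so
  -- `b ∈ I B`. The `+ 1` keeps the exponent positive.
  obtain ⟨b, hb⟩ := exists_sub_one_tmul_mem_map (J ^ (k + 1)) (hJ · (k + 1)) c
  have hbk : (1 : O) ⊗ₜ[A] (b ^ (k + 1)) ∈ (J ^ (k + 1)).map (algebraMap O (O ⊗[A] B)) := by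
    rw [← Ideal.Quotient.eq] at hb
    rw [← one_pow (M := O) (k + 1), ← Algebra.TensorProduct.tmul_pow, ← Ideal.Quotient.eq_zero_iff_mem,
      map_pow, ← hb, ← map_pow, pow_succ c, hk, zero_mul, map_zero]
  have hbI := IsIntegralClosure.mem_map_of_pow_mem_map_pow K L hI k.succ_pos
    (mem_map_of_one_tmul_mem_map _ _ (hIJ (k + 1)) _ hbk)
  have h1 : (1 : O) ⊗ₜ[A] b ∈ J.map (algebraMap O (O ⊗[A] B)) := by
    have hle : I ≤ J.comap (algebraMap A O) := by simpa using (hIJ 1).ge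
    have := Ideal.mem_map_of_mem
      (Algebra.TensorProduct.includeRight : B →ₐ[A] O ⊗[A] B).toRingHom hbI
    rw [Ideal.map_map] at this
    refine Ideal.map_le_iff_le_comap.2 (fun a ha => ?_) this
    have h := Ideal.mem_map_of_mem (algebraMap O (O ⊗[A] B)) (hle ha)
    simpa [← IsScalarTower.algebraMap_apply] using h
  have h2 := Ideal.map_mono (f := algebraMap O (O ⊗[A] B)) (Ideal.pow_le_self k.succ_ne_zero) hb
  simpa using add_mem h2 h1

/-! ### The semisimple quotient as the reduction, and the degree formula. -/

theorem semisimpleRadical_eq_nilradical (R : Type*) [CommRing R] [IsArtinianRing R] :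
    semisimpleRadical R = nilradical R := by
  have hleast := isLeast_semisimpleRadical R
  refine le_antisymm (hleast.2 ?_) ?_
  · have : IsReduced (R ⧸ nilradical R) := (Ideal.isRadical_iff_quotient_reduced _).1
      (Ideal.radical_isRadical _)
    exact IsArtinianRing.isSemisimpleRing_of_isReduced _
  · have : IsSemisimpleRing (R ⧸ semisimpleRadical R) := hleast.1
    intro x hx
    have h := (mem_nilradical.1 hx).map (Ideal.Quotient.mk (semisimpleRadical R))
    rw [← mem_nilradical] at h
    have h' := nilradical_le_jacobson _ h
    rw [IsSemisimpleRing.jacobson_eq_bot] at h'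
    exact Ideal.Quotient.eq_zero_iff_mem.1 h'

theorem finrank_quotient_nilradical_congr {F E E' : Type*} [Field F] [CommRing E] [CommRing E']
    [Algebra F E] [Algebra F E'] (e : E ≃ₐ[F] E') :
    Module.finrank F (E ⧸ nilradical E) = Module.finrank F (E' ⧸ nilradical E') := by
  refine (Ideal.quotientEquivAlg _ _ e ?_).toLinearEquiv.finrank_eq
  ext x
  refine ⟨fun hx => ?_, fun hx => ?_⟩
  · exact (Ideal.mem_map_of_equiv e x).2 ⟨e.symm x, (mem_nilradical.1 hx).map e.symm, by simp⟩
  · obtain ⟨y, hy, rfl⟩ := (Ideal.mem_map_of_equiv e x).1 hx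
    exact (mem_nilradical.1 hy).map e

/-- Clearing denominators identifies the base change of the integral closure with that of the
field extension. -/
noncomputable def IsIntegralClosure.tensorEquiv (A K L B F : Type*) [CommRing A] [IsDomain A]
    [Field K] [Algebra A K]
    [IsFractionRing A K] [Field L] [Algebra K L] [FiniteDimensional K L] [Algebra A L]
    [IsScalarTower A K L] [CommRing B] [Algebra A B] [Algebra B L] [IsScalarTower A B L]
    [IsIntegralClosure B A L] [Field F] [Algebra K F] [Algebra A F] [IsScalarTower A K F] :
    F ⊗[A] B ≃ₐ[F] L ⊗[K] F :=
  have : IsLocalization (Algebra.algebraMapSubmonoid B (nonZeroDivisors A)) L :=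
    IsIntegralClosure.isLocalization A K L B
  have : Algebra.IsPushout A K B L :=
    (Algebra.isPushout_of_isLocalization (nonZeroDivisors A) K B L).symm
  (Algebra.TensorProduct.cancelBaseChange A K F F B).symm.trans <|
    (Algebra.TensorProduct.congr .refl (Algebra.IsPushout.equiv A K B L)).trans
      (Algebra.TensorProduct.commRight K F L)

open IsDedekindDomain HeightOneSpectrum IsLocalRing in
theorem finrank_quotient_nilradical_tensor_adicCompletion (A K L B : Type*) [CommRing A]
    [IsDedekindDomain A] [Field K] [Algebra A K]
    [IsFractionRing A K] [Field L] [Algebra K L] [FiniteDimensional K L] [Algebra A L]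
    [IsScalarTower A K L] [CommRing B] [Algebra A B] [Algebra B L] [IsScalarTower A B L]
    [IsIntegralClosure B A L] (p : HeightOneSpectrum A)
    [Module.Finite (p.adicCompletion K) (p.adicCompletion K ⊗[A] B)] :
    Module.finrank (p.adicCompletion K)
        ((p.adicCompletion K ⊗[A] B) ⧸ nilradical (p.adicCompletion K ⊗[A] B)) =
      Module.finrank p.asIdeal.ResidueField (p.asIdeal.Fiber B) := by
  let O := p.adicCompletionIntegers K
  let F := p.adicCompletion K
  let N := nilradical (F ⊗[A] B)
  have : Module.IsTorsionFree A L := .trans_faithfulSMul A K L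
  have : Module.IsTorsionFree A B := IsIntegralClosure.isTorsionFree A L
  have : Algebra.IsIntegral A B := IsIntegralClosure.isIntegral_algebra A L
  have : Algebra.QuasiFinite A B := IsIntegralClosure.quasiFinite A K L B
  have : IsReduced (F ⊗[A] B ⧸ N) := (Ideal.isRadical_iff_quotient_reduced _).1
      (Ideal.radical_isRadical _)
  have hcomap (n : ℕ) : (maximalIdeal O ^ n).comap (algebraMap A O) = p.asIdeal ^ n :=
    Ideal.ext fun a => algebraMap_mem_maximalIdeal_pow_iff K p a n
  have : (maximalIdeal O).LiesOver p.asIdeal := ⟨by simpa using (hcomap 1).symm⟩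
  let g : O →ₐ[A] F := IsScalarTower.toAlgHom A O F
  let φ : O ⊗[A] B →ₐ[O] F ⊗[A] B := Algebra.TensorProduct.map (Algebra.ofId O F) (.id A B)
  -- `B` is torsion-free, hence flat, over `A`; so elements killed by `ψ` are nilpotent already in
  -- `O ⊗[A] B`.
  have hφ : Function.Injective φ :=
    Module.Flat.rTensor_preserves_injective_linearMap (M := B) g.toLinearMap
      Subtype.val_injective
  let ψ : O ⊗[A] B →ₐ[O] F ⊗[A] B ⧸ N := (Ideal.Quotient.mkₐ O N).comp φ
  rw [← Ideal.finrank_fiber_baseChange B O (maximalIdeal O) p.asIdeal]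
  refine finrank_eq_finrank_fiber ψ ?_ fun c hc => ?_
  · rw [eq_top_iff]
    rintro x -
    obtain ⟨x, rfl⟩ := Ideal.Quotient.mk_surjective x
    induction x using TensorProduct.induction_on with
    | zero => simp
    | tmul f b =>
      have : Ideal.Quotient.mk N (f ⊗ₜ[A] b) = f • ψ (1 ⊗ₜ b) := by
        have h : f ⊗ₜ[A] b = f • ((1 : F) ⊗ₜ[A] b) := by simp [TensorProduct.smul_tmul']
        rw [h]
        simp [ψ, φ]
        rfl
      rw [this]
      exact Submodule.smul_mem _ _ (Submodule.subset_span ⟨_, rfl⟩)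
    | add x y hx hy => rw [map_add]; exact add_mem hx hy
  · have hnil : IsNilpotent (φ c) := mem_nilradical.1 (Ideal.Quotient.eq_zero_iff_mem.1 hc)
    exact IsIntegralClosure.mem_map_of_isNilpotent_tmul K L p.ne_bot (maximalIdeal O)
      (exists_sub_algebraMap_mem_maximalIdeal_pow K p) hcomap ((IsNilpotent.map_iff hφ).1 hnil)

theorem theorem1 (A K L B : Type*) [CommRing A] [IsDedekindDomain A] [Field K] [Algebra A K]
    [IsFractionRing A K] [Field L] [Algebra K L] [FiniteDimensional K L] [Algebra A L]
    [IsScalarTower A K L] [CommRing B] [Algebra A B] [Algebra B L] [IsScalarTower A B L]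
    [IsIntegralClosure B A L] (p : IsDedekindDomain.HeightOneSpectrum A) :
    (p.asIdeal.primesOver B).Finite ∧
    (∀ P ∈ p.asIdeal.primesOver B, 0 < P.ramificationIdx A ∧ 0 < P.inertiaDeg A) ∧
    IsSemisimpleRing (MaxSemisimpleQuotient (L ⊗[K] p.adicCompletion K)) ∧
    ∑ᶠ P ∈ p.asIdeal.primesOver B, P.ramificationIdx A * P.inertiaDeg A =
      Module.finrank (p.adicCompletion K)
        (MaxSemisimpleQuotient (L ⊗[K] p.adicCompletion K)) := by
  have : Algebra.QuasiFinite A B := IsIntegralClosure.quasiFinite A K L B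
  let e := IsIntegralClosure.tensorEquiv A K L B (p.adicCompletion K)
  have : Module.Finite (p.adicCompletion K) (L ⊗[K] p.adicCompletion K) :=
    .equiv (Algebra.TensorProduct.commRight K (p.adicCompletion K) L).toLinearEquiv
  have : Module.Finite (p.adicCompletion K) (p.adicCompletion K ⊗[A] B) :=
    .equiv e.symm.toLinearEquiv
  have : IsArtinianRing (L ⊗[K] p.adicCompletion K) := .of_finite (p.adicCompletion K) _
  refine ⟨Algebra.QuasiFinite.finite_primesOver _, fun P hP => ?_,
    (isLeast_semisimpleRadical _).1, ?_⟩
  · have : P.IsPrime := hP.1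
    exact ⟨P.ramificationIdx_pos_of_quasiFinite, P.inertiaDeg_pos_of_quasiFinite⟩
  · rw [Ideal.finsum_ramificationIdx_mul_inertiaDeg]
    change _ = Module.finrank _ (_ ⧸ semisimpleRadical _)
    rw [semisimpleRadical_eq_nilradical, ← finrank_quotient_nilradical_congr e,
      finrank_quotient_nilradical_tensor_adicCompletion A K L B p]
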